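/- Let $L>0$. For real $p\ge 1$ let $$C_p(L)=\sup_{u\in H_0^1(0,L)\setminus\{0\}}\frac{\int_0^L|u(x)|^{p+1}\,dx}{\left(\int_0^L (u'(x))^2\,dx\right)^{(p+1)/2}},$$ and for $a,b>0$ let $B(a,b)=\int_0^1 t^{a-1}(1-t)^{b-1}\,dt$ be the Beta function. Then, for every real $p\ge1$: (i) $C_p(L)$ is finite and is the least constant $C$ such that $\int_0^L|u|^{p+1}\,dx\le C\left(\int_0^L(u')^2\,dx\right)^{(p+1)/2}$ for all $u\in H_0^1(0,L)$. (ii) The supremum is attained by some $u_*\in H_0^1(0,L)\cap C^2([0,L])$ with $u_*>0$ on $(0,L)$ that solves, for some $\mu>0$, the Emden-Fowler problem $-u_*''=\mu u_*^p$ on $(0,L)$, $u_*(0)=u_*(L)=0$. (iii) $$C_p(L)=L^{\frac{p+3}{2}}\left(\frac{p+1}{2}\right)^{\frac{p+1}{2}}\,\frac{1}{B\!\left(\frac1{p+1},\frac12\right)^{\frac{p+3}{2}}\,B\!\left(\frac{p+2}{p+1},\frac12\right)^{\frac{p-1}{2}}}.$$ In particular, for $p=1$, $C_1(L)=L^2/\pi^2$.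 -/

import Mathlib

open MeasureTheory Set
open scoped ContDiff

/-- `g` is a weak (distributional) derivative of `u` on the open interval `(0, L)`:
`∫ u φ' = - ∫ g φ` for every smooth `φ` with compact support in `(0, L)`. -/
def IsWeakDerivOn (L : ℝ) (u g : ℝ → ℝ) : Prop :=
  ∀ φ : ℝ → ℝ, ContDiff ℝ ∞ φ → HasCompactSupport φ → tsupport φ ⊆ Ioo 0 L →
    ∫ x in (0 : ℝ)..L, u x * deriv φ x = - ∫ x in (0 : ℝ)..L, g x * φ x

/-- `u` is the continuous representative of an element of the Sobolev space `H_0^1(0, L)`, and `g`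
is (a representative of) its weak derivative: `u` is continuous on `[0, L]` (hence in `L^2`) with
`u(0) = u(L) = 0`, and it has the weak derivative `g ∈ L^2(0, L)`. -/
structure IsH10 (L : ℝ) (u g : ℝ → ℝ) : Prop where
  continuousOn : ContinuousOn u (Icc 0 L)
  left_eq_zero : u 0 = 0
  right_eq_zero : u L = 0
  memLp_deriv : MemLp g 2 (volume.restrict (Ioo 0 L))
  isWeakDeriv : IsWeakDerivOn L u g

/-- `∫_0^L |u|^{p+1} dx`. -/
noncomputable def powerIntegral (p L : ℝ) (u : ℝ → ℝ) : ℝ :=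
  ∫ x in (0 : ℝ)..L, |u x| ^ (p + 1)

/-- `∫_0^L (u')^2 dx`, as a function of the derivative `g = u'`. -/
noncomputable def energy (L : ℝ) (g : ℝ → ℝ) : ℝ :=
  ∫ x in (0 : ℝ)..L, g x ^ 2

/-- The values of the quotient `∫ |u|^{p+1} / (∫ (u')^2)^{(p+1)/2}` over the nonzero elements of
`H_0^1(0, L)`. -/
def quotientValues (p L : ℝ) : Set ℝ :=
  {r | ∃ u g : ℝ → ℝ, IsH10 L u g ∧ (∃ x ∈ Icc 0 L, u x ≠ 0) ∧
    r = powerIntegral p L u / energy L g ^ ((p + 1) / 2)}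

/-- The optimal constant `C_p(L)`: the supremum of the quotient over `H_0^1(0, L) \ {0}`. -/
noncomputable def optimalConstant (p L : ℝ) : ℝ :=
  sSup (quotientValues p L)

/-! This is E. Schmidt's argument. Put `q = p + 1`, `M = max |u|`, `A = ∫ |u|^q`, `E = ∫ g²`, and `k
= ∫_0^M √(M^q - s^q) ds = M^(q/2+1) c`, where `c` is the same integral for `M = 1`. The graph of `u`
runs from 0 to height `M` in absolute value and back, so the change of variables `y = u(x)` gives
`2k ≤ ∫ √(M^q - |u|^q) |g|`. By the arithmetic-geometric mean inequality with a free weight `t`,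
`4tk ≤ t² E + L M^q - A`. The best `t` yields `A ≤ M^q (L - 4c² M² / E)`, and maximising over `M`
leaves an explicit constant times `E^(q/2)` (`IsH10.energy_pos_and_powerIntegral_le`).

Every step is an equality along a trajectory with `u'² = b² (1 - u^q)`. Such a trajectory is
constructed by separation of variables (`exists_emdenFowler_solution`). Its `A` and `E` follow from
two linear relations (`powerIntegral_and_energy_eq`), and Beta function identities match its
quotient with the upper bound. -/

/-! ### Weak derivatives, primitives and change of variables -/

theorem AbsolutelyContinuousOnInterval.lipschitzWith_comp {H U : ℝ → ℝ} {a b : ℝ} {K : NNReal}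
    (hH : LipschitzWith K H) (hU : AbsolutelyContinuousOnInterval U a b) :
    AbsolutelyContinuousOnInterval (fun x ↦ H (U x)) a b := by
  rw [absolutelyContinuousOnInterval_iff] at hU ⊢
  intro ε hε
  obtain ⟨δ, hδ, h⟩ := hU (ε / (K + 1)) (by positivity)
  refine ⟨δ, hδ, fun E hE hs ↦ ?_⟩
  have h1 := h E hE hs
  rw [lt_div_iff₀ (by positivity)] at h1
  refine lt_of_le_of_lt ?_ h1
  rw [Finset.sum_mul]
  refine Finset.sum_le_sum fun i _ ↦ ?_
  refine (hH.dist_le_mul _ _).trans ?_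
  nlinarith [dist_nonneg (x := U (E.2 i).1) (y := U (E.2 i).2)]

theorem eq_zero_of_notMem_Ioo_of_tsupport_subset {L x : ℝ} {φ : ℝ → ℝ}
    (h : tsupport φ ⊆ Ioo 0 L) (hx : x ∉ Ioo 0 L) : φ x = 0 :=
  image_eq_zero_of_notMem_tsupport fun hx' ↦ hx (h hx')

theorem integral_eq_intervalIntegral_of_tsupport_subset {L : ℝ} {φ : ℝ → ℝ}
    (h : tsupport φ ⊆ Ioo 0 L) (w : ℝ → ℝ) :
    ∫ x in (0 : ℝ)..L, w x * φ x = ∫ x, w x * φ x := by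
  refine intervalIntegral.integral_eq_integral_of_support_subset fun x hx ↦ ?_
  have : x ∈ Ioo 0 L := h (subset_tsupport _ (right_ne_zero_of_mul hx))
  exact Ioo_subset_Ioc_self this

/-- A smooth function with compact support in `(0, L)` and zero mean has a primitive of the same
kind. -/
theorem exists_testFunction_deriv_eq {L : ℝ} (hL : 0 < L) {ψ : ℝ → ℝ} (hψ : ContDiff ℝ ∞ ψ)
    (hc : HasCompactSupport ψ) (hs : tsupport ψ ⊆ Ioo 0 L) (h0 : ∫ x, ψ x = 0) :
    ∃ φ : ℝ → ℝ, ContDiff ℝ ∞ φ ∧ HasCompactSupport φ ∧ tsupport φ ⊆ Ioo 0 L ∧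
      deriv φ = ψ := by
  obtain ⟨a, b, ha, hb, hab⟩ : ∃ a b, 0 < a ∧ b < L ∧ tsupport ψ ⊆ Icc a b := by
    rcases (tsupport ψ).eq_empty_or_nonempty with he | hne
    · exact ⟨L / 3, L / 2, by positivity, by linarith, by simp [he]⟩
    · obtain ⟨a, ha, ha'⟩ := hc.isCompact.exists_isLeast hne
      obtain ⟨b, hb, hb'⟩ := hc.isCompact.exists_isGreatest hne
      exact ⟨a, b, (hs ha).1, (hs hb).2, fun x hx ↦ ⟨ha' hx, hb' hx⟩⟩
  have hd : ∀ x, HasDerivAt (fun x ↦ ∫ t in (0 : ℝ)..x, ψ t) (ψ x) x := fun x ↦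
    intervalIntegral.integral_hasDerivAt_right (hψ.continuous.intervalIntegrable _ _)
      (hψ.continuous.stronglyMeasurableAtFilter _ _) hψ.continuous.continuousAt
  have hd' : deriv (fun x ↦ ∫ t in (0 : ℝ)..x, ψ t) = ψ := funext fun x ↦ (hd x).deriv
  -- Left of `a` the integrand vanishes; right of `b` the primitive already equals the full mean,
  -- which is zero.
  have hsupp : tsupport (fun x ↦ ∫ t in (0 : ℝ)..x, ψ t) ⊆ Icc a b := by
    refine closure_minimal (fun x hx ↦ ?_) isClosed_Icc
    by_contra hx'
    refine hx ?_
    rcases lt_or_ge x a with h | h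
    · refine intervalIntegral.integral_zero_ae (Filter.Eventually.of_forall fun t ht ↦ ?_)
      refine image_eq_zero_of_notMem_tsupport fun ht' ↦ ?_
      have h1 := (hab ht').1
      rcases mem_uIoc.1 ht with h2 | h2 <;> linarith [h2.2]
    · have hbx : b < x := by
        by_contra hb'
        exact hx' ⟨h, not_lt.1 hb'⟩
      change ∫ t in (0 : ℝ)..x, ψ t = 0
      rw [intervalIntegral.integral_eq_integral_of_support_subset, h0]
      intro t ht
      have := hab (subset_tsupport _ ht)
      exact ⟨ha.trans_le this.1, this.2.trans hbx.le⟩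
  refine ⟨fun x ↦ ∫ t in (0 : ℝ)..x, ψ t, ?_, ?_, ?_, hd'⟩
  · rw [contDiff_infty_iff_deriv, hd']
    exact ⟨fun x ↦ (hd x).differentiableAt, hψ⟩
  · exact isCompact_Icc.of_isClosed_subset (isClosed_tsupport _) hsupp
  · exact hsupp.trans fun x hx ↦ ⟨ha.trans_le hx.1, hx.2.trans_lt hb⟩

/-- The lemma of du Bois-Reymond. -/
theorem exists_eq_const_of_integral_mul_deriv_eq_zero {L : ℝ} (hL : 0 < L) {w : ℝ → ℝ}
    (hw : ContinuousOn w (Icc 0 L))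
    (h : ∀ φ : ℝ → ℝ, ContDiff ℝ ∞ φ → HasCompactSupport φ → tsupport φ ⊆ Ioo 0 L →
      ∫ x in (0 : ℝ)..L, w x * deriv φ x = 0) :
    ∃ c, ∀ x ∈ Icc 0 L, w x = c := by
  let B : ContDiffBump (L / 2) := ⟨L / 8, L / 4, by positivity, by linarith⟩
  let ρ : ℝ → ℝ := B.normed volume
  have hρ : ContDiff ℝ ∞ ρ := B.contDiff_normed
  have hρc : HasCompactSupport ρ := B.hasCompactSupport_normed
  have hρs : tsupport ρ ⊆ Ioo 0 L := by
    rw [B.tsupport_normed_eq, Real.closedBall_eq_Icc]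
    change Icc (L / 2 - L / 4) (L / 2 + L / 4) ⊆ _
    exact fun x hx ↦ ⟨by linarith [hx.1], by linarith [hx.2]⟩
  have hρi : ∫ x, ρ x = 1 := B.integral_normed
  have hint : ∀ {ψ : ℝ → ℝ}, Continuous ψ →
      IntervalIntegrable (fun x ↦ w x * ψ x) volume 0 L := fun hψ ↦
    ContinuousOn.intervalIntegrable_of_Icc hL.le (hw.mul hψ.continuousOn)
  set c := ∫ x in (0 : ℝ)..L, w x * ρ x with hc
  have key : ∀ ψ : ℝ → ℝ, ContDiff ℝ ∞ ψ → HasCompactSupport ψ → tsupport ψ ⊆ Ioo 0 L →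
      ∫ x, ψ x • (w x - c) = 0 := by
    intro ψ hψ hψc hψs
    -- Subtracting `m * ρ` removes the mean of `ψ`, so the difference is the derivative of a test
    -- function and the hypothesis applies to it.
    set m := ∫ x, ψ x with hm
    have hχ : ContDiff ℝ ∞ (fun x ↦ ψ x - m * ρ x) := hψ.sub (contDiff_const.mul hρ)
    have hmρs : tsupport (fun x ↦ m * ρ x) ⊆ tsupport ρ := tsupport_mul_subset_right
    have hmρc : HasCompactSupport (fun x ↦ m * ρ x) := hρc.mul_left
    have hχs : tsupport (fun x ↦ ψ x - m * ρ x) ⊆ tsupport ψ ∪ tsupport ρ := by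
      refine (tsupport_sub _ _).trans (union_subset_union_right _ hmρs)
    obtain ⟨φ, hφ, hφc, hφs, hφd⟩ := exists_testFunction_deriv_eq hL hχ
      ((hψc.isCompact.union hρc.isCompact).of_isClosed_subset (isClosed_tsupport _) hχs)
      (hχs.trans (union_subset hψs hρs)) (by
        rw [integral_sub (hψ.continuous.integrable_of_hasCompactSupport hψc)
          ((contDiff_const.mul hρ).continuous.integrable_of_hasCompactSupport hmρc),
          integral_const_mul, hρi, ← hm]; ring)
    have h1 := h φ hφ hφc hφs
    rw [hφd] at h1
    have h2 : ∫ x in (0 : ℝ)..L, w x * (ψ x - m * ρ x)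
        = (∫ x in (0 : ℝ)..L, w x * ψ x) - m * c := by
      rw [hc, ← intervalIntegral.integral_const_mul, ← intervalIntegral.integral_sub
        (hint hψ.continuous) ((hint hρ.continuous).const_mul m)]
      refine intervalIntegral.integral_congr fun x _ ↦ ?_
      ring
    have h3 : ∫ x, ψ x • (w x - c) = ∫ x in (0 : ℝ)..L, (w x - c) * ψ x := by
      rw [integral_eq_intervalIntegral_of_tsupport_subset hψs (fun x ↦ w x - c)]
      simp [mul_comm]
    have h4 : ∫ x in (0 : ℝ)..L, (w x - c) * ψ x = (∫ x in (0 : ℝ)..L, w x * ψ x) - c * m := by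
      have : m = ∫ x in (0 : ℝ)..L, ψ x := by
        simpa using (integral_eq_intervalIntegral_of_tsupport_subset hψs (fun _ ↦ 1)).symm
      rw [this, ← intervalIntegral.integral_const_mul, ← intervalIntegral.integral_sub
        (hint hψ.continuous) ((hψ.continuous.intervalIntegrable _ _).const_mul c)]
      refine intervalIntegral.integral_congr fun x _ ↦ ?_
      ring
    rw [h3, h4]
    linarith
  have hae := isOpen_Ioo.ae_eq_zero_of_integral_contDiff_smul_eq_zero (μ := volume)
    (f := fun x ↦ w x - c) (U := Ioo 0 L)
    (((hw.mono Ioo_subset_Icc_self).sub continuousOn_const).locallyIntegrableOn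
      measurableSet_Ioo) key
  refine ⟨c, Measure.eqOn_Icc_of_ae_eq volume hL.ne ?_ hw continuousOn_const⟩
  rw [Filter.EventuallyEq, ae_restrict_iff' measurableSet_Icc]
  have e0 : ∀ᵐ x : ℝ, x ≠ 0 := by simp [ae_iff, measure_singleton]
  have eL : ∀ᵐ x : ℝ, x ≠ L := by simp [ae_iff, measure_singleton]
  filter_upwards [hae, e0, eL] with x hx h0 h1 hxI
  exact sub_eq_zero.1 (hx ⟨lt_of_le_of_ne hxI.1 h0.symm, lt_of_le_of_ne hxI.2 h1⟩)

section

variable {L : ℝ} {u g : ℝ → ℝ}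

theorem IsH10.intervalIntegrable_sq (hL : 0 < L) (h : IsH10 L u g) :
    IntervalIntegrable (fun x ↦ g x ^ 2) volume 0 L := by
  rw [intervalIntegrable_iff_integrableOn_Ioo_of_le hL.le]
  exact h.memLp_deriv.integrable_sq

theorem IsH10.intervalIntegrable (hL : 0 < L) (h : IsH10 L u g) :
    IntervalIntegrable g volume 0 L := by
  rw [intervalIntegrable_iff_integrableOn_Ioo_of_le hL.le]
  exact h.memLp_deriv.integrable (by norm_num)

theorem IsH10.absolutelyContinuousOnInterval (hL : 0 < L) (h : IsH10 L u g) :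
    AbsolutelyContinuousOnInterval (fun x ↦ ∫ t in (0 : ℝ)..x, g t) 0 L :=
  (h.intervalIntegrable hL).absolutelyContinuousOnInterval_intervalIntegral (by simp)

/-- The primitive of `g` is absolutely continuous, so it integrates by parts against test functions
exactly as `u` does. The difference annihilates every `φ'`, hence is constant by du Bois-Reymond,
and it vanishes at 0. -/
theorem IsH10.eq_integral (hL : 0 < L) (h : IsH10 L u g) :
    ∀ x ∈ Icc 0 L, u x = ∫ t in (0 : ℝ)..x, g t := by
  have hG := h.absolutelyContinuousOnInterval hL
  have hGc := hG.continuousOn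
  rw [uIcc_of_le hL.le] at hGc
  have hGd := (h.intervalIntegrable hL).ae_hasDerivAt_integral
  obtain ⟨c, hc⟩ := exists_eq_const_of_integral_mul_deriv_eq_zero hL (h.continuousOn.sub hGc) (by
    intro φ hφ hφc hφs
    have hφ1 : AbsolutelyContinuousOnInterval φ 0 L :=
      (hφ.of_le (by norm_cast)).contDiffOn.absolutelyContinuousOnInterval
    have hd := hφ.continuous_deriv (by norm_cast)
    have h1 := hG.integral_mul_deriv_eq_deriv_mul hφ1
    rw [eq_zero_of_notMem_Ioo_of_tsupport_subset hφs (x := L) (by simp),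
      eq_zero_of_notMem_Ioo_of_tsupport_subset hφs (x := 0) (by simp)] at h1
    have h2 : ∫ x in (0 : ℝ)..L, deriv (fun x ↦ ∫ t in (0 : ℝ)..x, g t) x * φ x
        = ∫ x in (0 : ℝ)..L, g x * φ x := by
      refine intervalIntegral.integral_congr_ae ?_
      filter_upwards [hGd] with x hx hxI
      rw [(hx (uIoc_subset_uIcc hxI) 0 (by simp)).deriv]
    have h3 := h.isWeakDeriv φ hφ hφc hφs
    have h4 : ∫ x in (0 : ℝ)..L, (u x - ∫ t in (0 : ℝ)..x, g t) * deriv φ x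
        = (∫ x in (0 : ℝ)..L, u x * deriv φ x)
          - ∫ x in (0 : ℝ)..L, (∫ t in (0 : ℝ)..x, g t) * deriv φ x := by
      rw [← intervalIntegral.integral_sub]
      · refine intervalIntegral.integral_congr fun x _ ↦ ?_
        ring
      · exact ContinuousOn.intervalIntegrable_of_Icc hL.le (h.continuousOn.mul hd.continuousOn)
      · exact ContinuousOn.intervalIntegrable_of_Icc hL.le (hGc.mul hd.continuousOn)
    rw [h2] at h1
    change ∫ x in (0 : ℝ)..L, (u x - ∫ t in (0 : ℝ)..x, g t) * deriv φ x = 0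
    rw [h4, h3, h1]
    ring)
  intro x hx
  have h0 := hc 0 (by simp [hL.le])
  have hx := hc x hx
  simp only [Pi.sub_apply, intervalIntegral.integral_same, h.left_eq_zero, sub_self] at h0 hx
  linarith

end

/-- The change of variables `y = u(x)` for `u ∈ H_0^1`. -/
theorem IsH10.integral_comp_mul {L : ℝ} {u g : ℝ → ℝ} (hL : 0 < L) (h : IsH10 L u g) {k : ℝ → ℝ}
    (hk : Continuous k) {K : NNReal} (hK : ∀ y, ‖k y‖₊ ≤ K) {a b : ℝ} (ha : a ∈ Icc 0 L)
    (hb : b ∈ Icc 0 L) :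
    ∫ x in a..b, k (u x) * g x = ∫ y in u a..u b, k y := by
  have hd : ∀ y, HasDerivAt (fun y ↦ ∫ s in (0 : ℝ)..y, k s) (k y) y := fun y ↦
    intervalIntegral.integral_hasDerivAt_right (hk.intervalIntegrable _ _)
      (hk.stronglyMeasurableAtFilter _ _) hk.continuousAt
  -- Boundedness of `k` makes its primitive Lipschitz, so its composition with `u` is absolutely
  -- continuous and the fundamental theorem applies with the a.e. chain rule. No monotonicity of `u`
  -- is needed.
  have hlip : LipschitzWith K (fun y ↦ ∫ s in (0 : ℝ)..y, k s) :=
    lipschitzWith_of_nnnorm_deriv_le (fun y ↦ (hd y).differentiableAt) fun y ↦ by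
      rw [(hd y).deriv]; exact hK y
  have hsub : uIcc a b ⊆ uIcc 0 L := by
    rw [uIcc_of_le hL.le]
    exact uIcc_subset_Icc ha hb
  have hac := ((h.absolutelyContinuousOnInterval hL).lipschitzWith_comp hlip).mono hsub
  have h1 := hac.integral_deriv_eq_sub
  rw [← h.eq_integral hL a ha, ← h.eq_integral hL b hb,
    intervalIntegral.integral_interval_sub_left (hk.intervalIntegrable _ _)
      (hk.intervalIntegrable _ _)] at h1
  rw [← h1]
  refine intervalIntegral.integral_congr_ae ?_
  filter_upwards [(h.intervalIntegrable hL).ae_hasDerivAt_integral] with x hx hxI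
  have hxL := hsub (uIoc_subset_uIcc hxI)
  rw [h.eq_integral hL x (by rwa [uIcc_of_le hL.le] at hxL)]
  exact ((hd _).comp x (hx hxL 0 (by simp))).deriv.symm

/-! ### Schmidt's inequality -/

/-- Along the trajectory of `-u'' = μ |u| ^ (q - 2) u` with maximum `M`, the speed `|u'|` is
proportional to this function of `u`. -/
noncomputable def trajectorySpeed (q M s : ℝ) : ℝ := √(M ^ q - |s| ^ q)

section

variable {q M s : ℝ}

theorem trajectorySpeed_nonneg : 0 ≤ trajectorySpeed q M s := Real.sqrt_nonneg _

theorem trajectorySpeed_neg : trajectorySpeed q M (-s) = trajectorySpeed q M s := by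
  simp [trajectorySpeed]

theorem continuous_trajectorySpeed (hq : 0 < q) : Continuous (trajectorySpeed q M) :=
  (continuous_const.sub (continuous_abs.rpow_const fun _ ↦ Or.inr hq.le)).sqrt

theorem trajectorySpeed_le : trajectorySpeed q M s ≤ √(M ^ q) :=
  Real.sqrt_le_sqrt (sub_le_self _ (by positivity))

theorem sq_trajectorySpeed (hq : 0 < q) (hs : |s| ≤ M) :
    trajectorySpeed q M s ^ 2 = M ^ q - |s| ^ q :=
  Real.sq_sqrt (sub_nonneg.2 (Real.rpow_le_rpow (abs_nonneg _) hs hq.le))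

theorem trajectorySpeed_mul (hM : 0 < M) (s : ℝ) :
    trajectorySpeed q M (M * s) = M ^ (q / 2) * trajectorySpeed q 1 s := by
  rw [trajectorySpeed, trajectorySpeed, abs_mul, abs_of_pos hM,
    Real.mul_rpow hM.le (abs_nonneg _), Real.one_rpow,
    show M ^ q - M ^ q * |s| ^ q = M ^ q * (1 - |s| ^ q) by ring,
    Real.sqrt_mul (by positivity), Real.sqrt_eq_rpow (M ^ q), ← Real.rpow_mul hM.le]
  ring_nf

theorem integral_trajectorySpeed (hM : 0 < M) :
    ∫ s in (0 : ℝ)..M, trajectorySpeed q M s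
      = M ^ (q / 2 + 1) * ∫ s in (0 : ℝ)..1, trajectorySpeed q 1 s := by
  have := intervalIntegral.mul_integral_comp_mul_left (a := 0) (b := 1)
    (f := trajectorySpeed q M) (c := M)
  rw [mul_zero, mul_one] at this
  simp_rw [trajectorySpeed_mul hM, intervalIntegral.integral_const_mul] at this
  rw [← this, Real.rpow_add_one hM.ne']
  ring

theorem abs_integral_trajectorySpeed (hM : |s| = M) :
    |∫ y in (0 : ℝ)..s, trajectorySpeed q M y| = ∫ y in (0 : ℝ)..M, trajectorySpeed q M y := by
  have h0 : 0 ≤ ∫ y in (0 : ℝ)..M, trajectorySpeed q M y :=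
    intervalIntegral.integral_nonneg (hM ▸ abs_nonneg s) fun _ _ ↦ trajectorySpeed_nonneg
  rcases abs_choice s with h | h
  · rw [← h, hM, abs_of_nonneg h0]
  · have h1 := intervalIntegral.integral_comp_neg (a := 0) (b := M) (f := trajectorySpeed q M)
    simp only [trajectorySpeed_neg, neg_zero] at h1
    rw [show s = -M by linarith, intervalIntegral.integral_symm, abs_neg, ← h1, abs_of_nonneg h0]

end

/-- The key inequality of E. Schmidt's argument. -/
theorem IsH10.two_mul_integral_trajectorySpeed_le {L q M : ℝ} {u g : ℝ → ℝ} (hL : 0 < L)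
    (hq : 0 < q) (h : IsH10 L u g) {x₀ : ℝ} (hx₀ : x₀ ∈ Icc 0 L) (hM : |u x₀| = M) :
    2 * ∫ s in (0 : ℝ)..M, trajectorySpeed q M s
      ≤ ∫ x in (0 : ℝ)..L, trajectorySpeed q M (u x) * |g x| := by
  have hk := continuous_trajectorySpeed (M := M) hq
  have hK : ∀ y, ‖trajectorySpeed q M y‖₊ ≤ Real.toNNReal (√(M ^ q)) := fun y ↦ by
    rw [← NNReal.coe_le_coe, coe_nnnorm, Real.coe_toNNReal _ (Real.sqrt_nonneg _),
      Real.norm_of_nonneg trajectorySpeed_nonneg]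
    exact trajectorySpeed_le
  have h0 : (0 : ℝ) ∈ Icc 0 L := ⟨le_rfl, hL.le⟩
  have hLL : L ∈ Icc 0 L := ⟨hL.le, le_rfl⟩
  -- Each side of `x₀` contributes one copy of the integral: `u` joins 0 to `±M` there, and evenness
  -- of the speed makes the sign irrelevant.
  have e1 := h.integral_comp_mul hL hk hK h0 hx₀
  have e2 := h.integral_comp_mul hL hk hK hx₀ hLL
  rw [h.left_eq_zero] at e1
  rw [h.right_eq_zero, intervalIntegral.integral_symm 0] at e2
  have hi : IntervalIntegrable (fun x ↦ trajectorySpeed q M (u x) * |g x|) volume 0 L := by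
    refine (h.intervalIntegrable hL).abs.continuousOn_mul ?_
    rw [uIcc_of_le hL.le]
    exact hk.comp_continuousOn h.continuousOn
  have habs : ∀ x, |trajectorySpeed q M (u x) * g x| = trajectorySpeed q M (u x) * |g x| :=
    fun x ↦ by rw [abs_mul, abs_of_nonneg trajectorySpeed_nonneg]
  have i1 := intervalIntegral.abs_integral_le_integral_abs (μ := volume)
    (f := fun x ↦ trajectorySpeed q M (u x) * g x) hx₀.1
  have i2 := intervalIntegral.abs_integral_le_integral_abs (μ := volume)
    (f := fun x ↦ trajectorySpeed q M (u x) * g x) hx₀.2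
  simp only [habs] at i1 i2
  rw [e1, abs_integral_trajectorySpeed hM] at i1
  rw [e2, abs_neg, abs_integral_trajectorySpeed hM] at i2
  rw [← intervalIntegral.integral_add_adjacent_intervals (b := x₀)
    (hi.mono_set (by rw [uIcc_of_le hx₀.1, uIcc_of_le hL.le]; exact Icc_subset_Icc le_rfl hx₀.2))
    (hi.mono_set (by rw [uIcc_of_le hx₀.2, uIcc_of_le hL.le]; exact Icc_subset_Icc hx₀.1 le_rfl))]
  linarith

/-- Integrate `2ab ≤ a² + b²` with `a = t |g|` and `b` the speed; maximality of `M` turns `b²` into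
`M^(p+1) - |u|^(p+1)`. The weight `t` stays free for a later optimisation. -/
theorem IsH10.four_mul_integral_trajectorySpeed_le {L p M : ℝ} {u g : ℝ → ℝ} (hL : 0 < L)
    (hp : 0 < p + 1) (h : IsH10 L u g) {x₀ : ℝ} (hx₀ : x₀ ∈ Icc 0 L) (hM : |u x₀| = M)
    (hmax : ∀ x ∈ Icc 0 L, |u x| ≤ M) {t : ℝ} (ht : 0 ≤ t) :
    4 * t * ∫ s in (0 : ℝ)..M, trajectorySpeed (p + 1) M s
      ≤ t ^ 2 * energy L g + (L * M ^ (p + 1) - powerIntegral p L u) := by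
  have h1 := h.two_mul_integral_trajectorySpeed_le hL hp hx₀ hM
  have hc : ContinuousOn (fun x ↦ |u x| ^ (p + 1)) (Icc 0 L) :=
    h.continuousOn.abs.rpow_const fun _ _ ↦ Or.inr hp.le
  have hA : IntervalIntegrable (fun x ↦ M ^ (p + 1) - |u x| ^ (p + 1)) volume 0 L :=
    ContinuousOn.intervalIntegrable_of_Icc hL.le (continuousOn_const.sub hc)
  have hE := (h.intervalIntegrable_sq hL).const_mul (t ^ 2)
  have hi : IntervalIntegrable (fun x ↦ trajectorySpeed (p + 1) M (u x) * |g x|) volume 0 L := by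
    refine (h.intervalIntegrable hL).abs.continuousOn_mul ?_
    rw [uIcc_of_le hL.le]
    exact (continuous_trajectorySpeed hp).comp_continuousOn h.continuousOn
  have h2 : 2 * t * ∫ x in (0 : ℝ)..L, trajectorySpeed (p + 1) M (u x) * |g x|
      ≤ ∫ x in (0 : ℝ)..L, (t ^ 2 * g x ^ 2 + (M ^ (p + 1) - |u x| ^ (p + 1))) := by
    rw [← intervalIntegral.integral_const_mul]
    refine intervalIntegral.integral_mono_on hL.le (hi.const_mul _) (hE.add hA) fun x hx ↦ ?_
    rw [← sq_trajectorySpeed hp (hmax x hx), ← sq_abs (g x)]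
    nlinarith [sq_nonneg (t * |g x| - trajectorySpeed (p + 1) M (u x))]
  rw [intervalIntegral.integral_add hE hA, intervalIntegral.integral_const_mul,
    intervalIntegral.integral_sub (by simp)
      (ContinuousOn.intervalIntegrable_of_Icc hL.le hc), intervalIntegral.integral_const] at h2
  simp only [smul_eq_mul, sub_zero] at h2
  unfold energy powerIntegral
  nlinarith

/-! ### Optimisation and the upper bound -/

/-- Bernoulli's inequality with exponent `r + 1` at `1/z`, multiplied by `z^(r+1)`. Equality holds
at `z = 1`, so this replaces a calculus argument for the maximum over `M`. -/
theorem rpow_mul_add_one_sub_mul_le_one {r z : ℝ} (hr : 1 ≤ r) (hz : 0 < z) :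
    z ^ r * (r + 1 - r * z) ≤ 1 := by
  have h := one_add_mul_self_le_rpow_one_add (s := z⁻¹ - 1) (p := r + 1)
    (by linarith [inv_pos.2 hz]) (by linarith)
  rw [add_sub_cancel, Real.inv_rpow hz.le, Real.rpow_add_one hz.ne'] at h
  have hzr : 0 < z ^ r := Real.rpow_pos_of_pos hz r
  have h2 := mul_le_mul_of_nonneg_left h (mul_pos hzr hz).le
  rw [mul_inv_cancel₀ (mul_pos hzr hz).ne'] at h2
  have h3 : z ^ r * z * (1 + (r + 1) * (z⁻¹ - 1)) = z ^ r * (r + 1 - r * z) := by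
    field_simp
    ring
  linarith

/-- The maximum over `M > 0` of `M ^ q (L - b M ^ 2)`. -/
theorem rpow_mul_sub_mul_sq_le {q L b M : ℝ} (hq : 2 ≤ q) (hL : 0 < L) (hb : 0 < b) (hM : 0 < M) :
    M ^ q * (L - b * M ^ 2) ≤ 2 * L / (q + 2) * (L * q / (b * (q + 2))) ^ (q / 2) := by
  have hq0 : 0 < q := by linarith
  have hW : 0 < L * q / (b * (q + 2)) := by positivity
  -- The denominator is the critical value of `M²`, so the maximum sits at ratio 1.
  have hz : 0 < M ^ 2 / (L * q / (b * (q + 2))) := by positivity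
  have h := rpow_mul_add_one_sub_mul_le_one (r := q / 2) (by linarith) hz
  have hM2 : (M ^ 2 : ℝ) ^ (q / 2) = M ^ q := by
    rw [← Real.rpow_natCast, ← Real.rpow_mul hM.le]
    norm_num
    ring_nf
  rw [Real.div_rpow (by positivity) hW.le, hM2] at h
  set W := (L * q / (b * (q + 2))) ^ (q / 2) with hWd
  have hWp : 0 < W := Real.rpow_pos_of_pos hW _
  have h2 := mul_le_mul_of_nonneg_left h (show 0 ≤ 2 * L / (q + 2) * W by positivity)
  have h3 : 2 * L / (q + 2) * W * (M ^ q / W * (q / 2 + 1 - q / 2 * (M ^ 2 / (L * q / (b * (q + 2))))))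
      = M ^ q * (L - b * M ^ 2) := by
    field_simp
  linarith

theorem integral_trajectorySpeed_one_pos {q : ℝ} (hq : 0 < q) :
    0 < ∫ s in (0 : ℝ)..1, trajectorySpeed q 1 s := by
  refine intervalIntegral.intervalIntegral_pos_of_pos_on
    ((continuous_trajectorySpeed hq).intervalIntegrable _ _) (fun s hs ↦ ?_) one_pos
  rw [trajectorySpeed, Real.sqrt_pos, Real.one_rpow, sub_pos, abs_of_pos hs.1]
  exact Real.rpow_lt_one hs.1.le hs.2 hq

theorem energy_nonneg {L : ℝ} {g : ℝ → ℝ} (hL : 0 < L) : 0 ≤ energy L g :=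
  intervalIntegral.integral_nonneg hL.le fun _ _ ↦ sq_nonneg _

theorem IsH10.energy_pos_and_powerIntegral_le {L p : ℝ} {u g : ℝ → ℝ} (hL : 0 < L) (hp : 1 ≤ p)
    (h : IsH10 L u g) (hu : ∃ x ∈ Icc 0 L, u x ≠ 0) :
    0 < energy L g ∧ powerIntegral p L u ≤ 2 * L / (p + 3) *
      (L * (p + 1) / (4 * (∫ s in (0 : ℝ)..1, trajectorySpeed (p + 1) 1 s) ^ 2 * (p + 3)))
        ^ ((p + 1) / 2) * energy L g ^ ((p + 1) / 2) := by
  obtain ⟨x₀, hx₀, hmax⟩ := isCompact_Icc.exists_isMaxOn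
    (nonempty_Icc.2 hL.le) h.continuousOn.abs
  obtain ⟨x₁, hx₁, hne⟩ := hu
  have hM : 0 < |u x₀| := (abs_pos.2 hne).trans_le (hmax hx₁)
  have key := fun (t : ℝ) (ht : 0 ≤ t) ↦ h.four_mul_integral_trajectorySpeed_le (p := p) hL
    (by linarith) hx₀ rfl (fun x hx ↦ hmax hx) ht
  have hc := integral_trajectorySpeed_one_pos (q := p + 1) (by linarith)
  rw [integral_trajectorySpeed hM] at key
  set c := ∫ s in (0 : ℝ)..1, trajectorySpeed (p + 1) 1 s
  set M := |u x₀|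
  have hk : 0 < M ^ ((p + 1) / 2 + 1) * c := by positivity
  have hk2 : (M ^ ((p + 1) / 2 + 1) * c) ^ 2 = M ^ (p + 1) * M ^ 2 * c ^ 2 := by
    rw [Real.rpow_add_one hM.ne', mul_pow, mul_pow, ← Real.rpow_natCast (M ^ _),
      ← Real.rpow_mul hM.le]
    norm_num
  set k := M ^ ((p + 1) / 2 + 1) * c
  have hE0 : 0 ≤ energy L g := energy_nonneg hL
  -- With zero energy the bound `4tk ≤ D` would hold for all `t ≥ 0`, which fails since `k > 0`.
  have hE : 0 < energy L g := by
    refine lt_of_le_of_ne hE0 fun hE ↦ ?_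
    rw [← hE] at key
    set D := L * M ^ (p + 1) - powerIntegral p L u
    have hD := key 0 le_rfl
    have h1 := key ((D + 1) / (4 * k)) (by
      have : 0 ≤ D := by linarith
      positivity)
    have h2 : 4 * ((D + 1) / (4 * k)) * k = D + 1 := by field_simp
    linarith
  refine ⟨hE, ?_⟩
  -- This `t` maximises `4tk - t² E`.
  have h1 := key (2 * k / energy L g) (by positivity)
  have h2 : 4 * (2 * k / energy L g) * k = 8 * k ^ 2 / energy L g := by ring
  have h3 : (2 * k / energy L g) ^ 2 * energy L g = 4 * k ^ 2 / energy L g := by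
    field_simp
    ring
  rw [h2, h3] at h1
  have h4 : powerIntegral p L u ≤ M ^ (p + 1) * (L - 4 * c ^ 2 / energy L g * M ^ 2) := by
    have : 8 * k ^ 2 / energy L g = 4 * k ^ 2 / energy L g + 4 * k ^ 2 / energy L g := by ring
    have h5 : M ^ (p + 1) * (L - 4 * c ^ 2 / energy L g * M ^ 2)
        = L * M ^ (p + 1) - 4 * k ^ 2 / energy L g := by rw [hk2]; ring
    linarith
  refine h4.trans ((rpow_mul_sub_mul_sq_le (by linarith) hL (by positivity) hM).trans_eq ?_)
  have h6 : L * (p + 1) / (4 * c ^ 2 / energy L g * (p + 1 + 2))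
      = L * (p + 1) / (4 * c ^ 2 * (p + 3)) * energy L g := by
    field_simp
    ring
  rw [h6, Real.mul_rpow (by positivity) hE.le]
  ring

/-! ### Construction of the extremal trajectory -/

theorem intervalIntegrable_rpow_mul_one_sub_rpow {a b : ℝ} (ha : 0 < a) (hb : 0 < b) :
    IntervalIntegrable (fun x : ℝ ↦ x ^ (a - 1) * (1 - x) ^ (b - 1)) volume 0 1 := by
  have h := Complex.betaIntegral_convergent (u := a) (v := b) (by simpa) (by simpa)
  rw [intervalIntegrable_iff_integrableOn_Ioc_of_le zero_le_one] at h ⊢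
  refine IntegrableOn.congr_fun h.re (fun x hx ↦ ?_) measurableSet_Ioc
  simp only [RCLike.re_to_complex]
  norm_cast
  rw [← Complex.ofReal_cpow hx.1.le, ← Complex.ofReal_cpow (sub_nonneg.2 hx.2)]
  norm_cast

theorem integral_rpow_mul_one_sub_rpow {a b : ℝ} (ha : 0 < a) (hb : 0 < b) :
    ∫ x in (0 : ℝ)..1, x ^ (a - 1) * (1 - x) ^ (b - 1) = ProbabilityTheory.beta a b := by
  rw [ProbabilityTheory.beta_eq_betaIntegralReal a b ha hb, Complex.betaIntegral,
    ← Complex.ofReal_re (∫ x in (0 : ℝ)..1, x ^ (a - 1) * (1 - x) ^ (b - 1)),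
    ← intervalIntegral.integral_ofReal]
  congr 1
  refine intervalIntegral.integral_congr fun x hx ↦ ?_
  rw [uIcc_of_le zero_le_one] at hx
  rw [Complex.ofReal_mul, Complex.ofReal_cpow hx.1, Complex.ofReal_cpow (sub_nonneg.2 hx.2)]
  push_cast
  rfl

/-- Separation of variables for `y' = 1 / ρ(y)`. -/
theorem exists_hasDerivAt_inv_of_integral_eq {L : ℝ} {ρ : ℝ → ℝ}
    (hρc : ContinuousOn ρ (Ioo 0 1)) (hρ : ∀ s ∈ Ioo (0 : ℝ) 1, 0 < ρ s)
    (hρi : IntervalIntegrable ρ volume 0 1) (hL : ∫ s in (0 : ℝ)..1, ρ s = L) :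
    ∃ y : ℝ → ℝ, Continuous y ∧ y 0 = 0 ∧ y L = 1 ∧
      ∀ x ∈ Ioo 0 L, y x ∈ Ioo 0 1 ∧ HasDerivAt y (ρ (y x))⁻¹ x := by
  -- Extending `ρ` by 1 outside the interval makes the primitive `F` an increasing bijection of the
  -- whole line, whose inverse is the desired `y`.
  let σ : ℝ → ℝ := fun s ↦ 1 + (Ioo (0 : ℝ) 1).indicator (fun s ↦ ρ s - 1) s
  have hσ1 : ∀ s ∈ Ioo (0 : ℝ) 1, σ s = ρ s := fun s hs ↦ by simp [σ, indicator_of_mem hs]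
  have hσ0 : ∀ s, s ∉ Ioo (0 : ℝ) 1 → σ s = 1 := fun s hs ↦ by simp [σ, indicator_of_notMem hs]
  have hσpos : ∀ s, 0 < σ s := fun s ↦ by
    by_cases hs : s ∈ Ioo (0 : ℝ) 1
    · rw [hσ1 s hs]; exact hρ s hs
    · rw [hσ0 s hs]; exact one_pos
  have hσi : ∀ a b, IntervalIntegrable σ volume a b := fun a b ↦ by
    refine intervalIntegrable_const.add (Integrable.intervalIntegrable ?_)
    rw [integrable_indicator_iff measurableSet_Ioo,
      ← intervalIntegrable_iff_integrableOn_Ioo_of_le zero_le_one]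
    exact hρi.sub intervalIntegrable_const
  set F : ℝ → ℝ := fun s ↦ ∫ t in (0 : ℝ)..s, σ t with hF
  have hFsub : ∀ a b, F b - F a = ∫ t in a..b, σ t := fun a b ↦
    intervalIntegral.integral_interval_sub_left (hσi _ _) (hσi _ _)
  have hFmono : StrictMono F := fun a b hab ↦ by
    have := intervalIntegral.intervalIntegral_pos_of_pos (hσi a b) hσpos hab
    rw [← hFsub] at this
    linarith
  have hF0 : F 0 = 0 := intervalIntegral.integral_same
  have hF1 : F 1 = L := by
    rw [← hL]
    refine intervalIntegral.integral_congr_ae ?_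
    filter_upwards [Measure.ae_ne volume (1 : ℝ)] with s hs hsI
    rw [uIoc_of_le zero_le_one] at hsI
    exact hσ1 s ⟨hsI.1, lt_of_le_of_ne hsI.2 hs⟩
  have hFc : Continuous F := intervalIntegral.continuous_primitive hσi 0
  have hFtop : Filter.Tendsto F Filter.atTop Filter.atTop := by
    refine (Filter.tendsto_atTop_add_const_right _ (L - 1) Filter.tendsto_id).congr' ?_
    filter_upwards [Filter.eventually_ge_atTop 1] with s hs
    have h1 : ∫ t in (1 : ℝ)..s, σ t = ∫ t in (1 : ℝ)..s, (1 : ℝ) :=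
      intervalIntegral.integral_congr fun t ht ↦ hσ0 t fun ht' ↦ by
        rw [uIcc_of_le hs] at ht
        exact absurd ht.1 (not_le.2 ht'.2)
    have h2 := hFsub 1 s
    rw [h1, hF1] at h2
    simp at h2
    simp only [id]
    linarith
  have hFbot : Filter.Tendsto F Filter.atBot Filter.atBot := by
    refine Filter.tendsto_id.congr' ?_
    filter_upwards [Filter.eventually_le_atBot 0] with s hs
    have h1 : ∫ t in s..(0 : ℝ), σ t = ∫ t in s..(0 : ℝ), (1 : ℝ) :=
      intervalIntegral.integral_congr fun t ht ↦ hσ0 t fun ht' ↦ by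
        rw [uIcc_of_le hs] at ht
        exact absurd ht.2 (not_le.2 ht'.1)
    have h2 := hFsub s 0
    rw [h1, hF0] at h2
    simp at h2
    simp only [id]
    linarith
  let e : ℝ ≃o ℝ := hFmono.orderIsoOfSurjective F (hFc.surjective hFtop hFbot)
  have he : ∀ s, e s = F s := fun _ ↦ rfl
  have h0 : e.symm 0 = 0 := by rw [e.symm_apply_eq, he, hF0]
  have h1 : e.symm L = 1 := by rw [e.symm_apply_eq, he, hF1]
  refine ⟨e.symm, e.symm.continuous, h0, h1, fun x hx ↦ ?_⟩
  have hy : e.symm x ∈ Ioo (0 : ℝ) 1 :=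
    ⟨by rw [← h0]; exact e.symm.strictMono hx.1, by rw [← h1]; exact e.symm.strictMono hx.2⟩
  refine ⟨hy, ?_⟩
  have hnear : σ =ᶠ[nhds (e.symm x)] ρ := by
    filter_upwards [isOpen_Ioo.mem_nhds hy] with s hs using hσ1 s hs
  have hd : HasDerivAt F (ρ (e.symm x)) (e.symm x) := by
    rw [← hσ1 _ hy]
    refine intervalIntegral.integral_hasDerivAt_right (hσi _ _) ?_ ?_
    · have := (hσi 0 1).1.aestronglyMeasurable
      exact ⟨Ioc 0 1, mem_nhds_iff.2 ⟨Ioo 0 1, Ioo_subset_Ioc_self, isOpen_Ioo, hy⟩, this⟩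
    · exact ((hρc.continuousAt (isOpen_Ioo.mem_nhds hy)).congr hnear.symm)
  exact HasDerivAt.of_local_left_inverse e.symm.continuous.continuousAt hd (hρ _ hy).ne'
    (Filter.Eventually.of_forall fun t ↦ e.apply_symm_apply t)

/-- The Emden-Fowler trajectory with maximum `1` on `[0, L]`. -/
theorem exists_emdenFowler_solution {L p b : ℝ} (hL : 0 < L) (hp : 1 ≤ p)
    (hb : b = 1 / (p + 1) * 4 ^ (1 / (p + 1)) *
      ProbabilityTheory.beta (1 / (p + 1)) (1 / (p + 1)) / L) :
    ∃ u : ℝ → ℝ, ContDiff ℝ 2 u ∧ u 0 = 0 ∧ u L = 0 ∧ (∀ x ∈ Ioo 0 L, 0 < u x) ∧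
      (∀ x ∈ Icc 0 L, deriv (deriv u) x = - (b ^ 2 * (p + 1) / 2 * u x ^ p)) ∧
      ∀ x ∈ Icc 0 L, deriv u x ^ 2 = b ^ 2 * (1 - u x ^ (p + 1)) := by
  have hp1 : 0 < p + 1 := by linarith
  set d := 1 / (p + 1) with hd
  have hd0 : 0 < d := by positivity
  have hpd : (p + 1) * d = 1 := by rw [hd]; field_simp
  have hB : 0 < ProbabilityTheory.beta d d := ProbabilityTheory.beta_pos hd0 hd0
  -- `K` normalises the density `s^(d-1) (1-s)^(d-1)` so that `y` takes exactly time `L` to go from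
  -- 0 to 1.
  set K := ProbabilityTheory.beta d d / L with hK
  have hK0 : 0 < K := by positivity
  have hbK : b = d * 4 ^ d * K := by rw [hb, hK]; ring
  obtain ⟨y, hyc, hy0, hyL, hy⟩ := exists_hasDerivAt_inv_of_integral_eq (L := L)
    (ρ := fun s ↦ K⁻¹ * (s ^ (d - 1) * (1 - s) ^ (d - 1)))
    (continuousOn_const.mul ((continuousOn_id.rpow_const fun s hs ↦ Or.inl hs.1.ne').mul
      ((continuousOn_const.sub continuousOn_id).rpow_const
        fun s hs ↦ Or.inl (sub_pos.2 hs.2).ne')))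
    (fun s hs ↦ mul_pos (inv_pos.2 hK0) (mul_pos (Real.rpow_pos_of_pos hs.1 _)
      (Real.rpow_pos_of_pos (sub_pos.2 hs.2) _)))
    ((intervalIntegrable_rpow_mul_one_sub_rpow hd0 hd0).const_mul _)
    (by rw [intervalIntegral.integral_const_mul, integral_rpow_mul_one_sub_rpow hd0 hd0, hK]
        field_simp)
  have hyI : ∀ x ∈ Icc 0 L, y x ∈ Icc 0 1 := by
    intro x hx
    rcases eq_or_lt_of_le hx.1 with h | h
    · rw [← h, hy0]; simp
    rcases eq_or_lt_of_le hx.2 with h' | h'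
    · rw [h', hyL]; simp
    · exact Ioo_subset_Icc_self (hy x ⟨h, h'⟩).1
  have hq0 : ∀ x ∈ Icc 0 L, 0 ≤ 4 * (y x * (1 - y x)) := fun x hx ↦ by
    have := hyI x hx
    exact mul_nonneg (by norm_num) (mul_nonneg this.1 (sub_nonneg.2 this.2))
  have hqp : ∀ x ∈ Ioo 0 L, 0 < 4 * (y x * (1 - y x)) := fun x hx ↦ by
    have := (hy x hx).1
    exact mul_pos (by norm_num) (mul_pos this.1 (sub_pos.2 this.2))
  -- As `y` increases from 0 to 1, `v` rises from 0 to 1 and returns, so the turning point `y =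
  -- 1/2`, where the speed vanishes, needs no gluing. Here `v' = b (1 - 2y)`, whose square is `b² (1
  -- - v^(p+1))`.
  set v : ℝ → ℝ := fun x ↦ (4 * (y x * (1 - y x))) ^ d with hv
  have hvc : Continuous v :=
    (continuous_const.mul (hyc.mul (continuous_const.sub hyc))).rpow_const
      fun _ ↦ Or.inr hd0.le
  have hvpow : ∀ x ∈ Icc 0 L, v x ^ p = (4 * (y x * (1 - y x))) ^ (1 - d) := fun x hx ↦ by
    rw [hv]
    simp only
    rw [← Real.rpow_mul (hq0 x hx)]
    congr 1
    linarith
  have hvpow' : ∀ x ∈ Icc 0 L, v x ^ (p + 1) = 4 * (y x * (1 - y x)) := fun x hx ↦ by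
    rw [hv]
    simp only
    rw [← Real.rpow_mul (hq0 x hx), mul_comm d, hpd, Real.rpow_one]
  have hyd : ∀ x ∈ Ioo 0 L,
      HasDerivAt y (K * 4 ^ (d - 1) * (4 * (y x * (1 - y x))) ^ (1 - d)) x := by
    intro x hx
    obtain ⟨hyx, h⟩ := hy x hx
    convert h using 1
    have h1 := sub_pos.2 hyx.2
    rw [← Real.mul_rpow hyx.1.le h1.le, Real.mul_rpow (by norm_num) (mul_pos hyx.1 h1).le, mul_inv,
      inv_inv, ← Real.rpow_neg (mul_pos hyx.1 h1).le, neg_sub]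
    have : (4 : ℝ) ^ (d - 1) * 4 ^ (1 - d) = 1 := by
      rw [← Real.rpow_add (by norm_num)]; simp
    linear_combination (K * (y x * (1 - y x)) ^ (1 - d)) * this
  set μ := b ^ 2 * (p + 1) / 2 with hμ
  have h4 : (4 : ℝ) ^ d = 4 * 4 ^ (d - 1) := by
    rw [Real.rpow_sub_one (by norm_num)]; ring
  have hμ' : μ = 2 * b * (K * 4 ^ (d - 1)) := by
    rw [hμ, sq]
    nth_rewrite 2 [hbK]
    rw [h4]
    linear_combination (2 * b * 4 ^ (d - 1) * K) * hpd
  have hwd : ∀ x ∈ Ioo 0 L, HasDerivAt (fun x ↦ b * (1 - 2 * y x)) (-(μ * v x ^ p)) x := by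
    intro x hx
    rw [hvpow x (Ioo_subset_Icc_self hx)]
    refine ((((hyd x hx).const_mul 2).const_sub 1).const_mul b).congr_deriv ?_
    rw [hμ']
    ring
  have hvd : ∀ x ∈ Ioo 0 L, HasDerivAt v (b * (1 - 2 * y x)) x := by
    intro x hx
    have h1 := ((hyd x hx).mul ((hyd x hx).const_sub 1)).const_mul 4
    have h2 := h1.rpow_const (p := d) (Or.inl (hqp x hx).ne')
    refine h2.congr_deriv ?_
    have h3 : (4 * (y x * (1 - y x))) ^ (1 - d) * (4 * (y x * (1 - y x))) ^ (d - 1) = 1 := by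
      rw [← Real.rpow_add (hqp x hx)]; simp
    simp only [Pi.mul_apply]
    rw [hbK, h4]
    linear_combination (d * 4 * 4 ^ (d - 1) * K * (1 - 2 * y x)) * h3
  -- The derivative formulas for `v` are known only inside `(0, L)`. Integrating the continuous
  -- right-hand side twice gives a function that is C² on the whole line and agrees with `v` on `[0,
  -- L]`, so the equation also holds at the endpoints.
  have hfc : Continuous fun x ↦ -(μ * v x ^ p) :=
    (continuous_const.mul (hvc.rpow_const fun _ ↦ Or.inr (by linarith))).neg
  set w : ℝ → ℝ := fun x ↦ b + ∫ t in (0 : ℝ)..x, -(μ * v t ^ p) with hw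
  have hw' : ∀ x, HasDerivAt w (-(μ * v x ^ p)) x := fun x ↦
    (intervalIntegral.integral_hasDerivAt_right (hfc.intervalIntegrable _ _)
      (hfc.stronglyMeasurableAtFilter _ _) hfc.continuousAt).const_add b
  have hwc : Continuous w := continuous_iff_continuousAt.2 fun x ↦ (hw' x).continuousAt
  have hwy : ∀ x ∈ Icc 0 L, w x = b * (1 - 2 * y x) := by
    intro x hx
    have := intervalIntegral.integral_eq_sub_of_hasDerivAt_of_le hx.1
      (f := fun x ↦ b * (1 - 2 * y x)) (by fun_prop)
      (fun t ht ↦ hwd t ⟨ht.1, ht.2.trans_le hx.2⟩) (hfc.intervalIntegrable _ _)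
    rw [hw]
    simp only
    rw [this, hy0]
    ring
  set u : ℝ → ℝ := fun x ↦ ∫ t in (0 : ℝ)..x, w t with hu
  have hu' : ∀ x, HasDerivAt u (w x) x := fun x ↦
    intervalIntegral.integral_hasDerivAt_right (hwc.intervalIntegrable _ _)
      (hwc.stronglyMeasurableAtFilter _ _) hwc.continuousAt
  have huv : ∀ x ∈ Icc 0 L, u x = v x := by
    intro x hx
    have := intervalIntegral.integral_eq_sub_of_hasDerivAt_of_le hx.1
      (f := v) hvc.continuousOn (f' := w)
      (fun t ht ↦ by
        have ht' : t ∈ Ioo 0 L := ⟨ht.1, ht.2.trans_le hx.2⟩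
        rw [hwy t (Ioo_subset_Icc_self ht')]
        exact hvd t ht') (hwc.intervalIntegrable _ _)
    rw [hu]
    simp only
    rw [this, hv]
    simp [hy0, Real.zero_rpow hd0.ne']
  have hdu : deriv u = w := funext fun x ↦ (hu' x).deriv
  have hdw : deriv w = fun x ↦ -(μ * v x ^ p) := funext fun x ↦ (hw' x).deriv
  have hw1 : ContDiff ℝ 1 w :=
    contDiff_one_iff_deriv.2 ⟨fun x ↦ (hw' x).differentiableAt, by rw [hdw]; exact hfc⟩
  refine ⟨u, ?_, ?_, ?_, fun x hx ↦ ?_, fun x hx ↦ ?_, fun x hx ↦ ?_⟩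
  · rw [show (2 : WithTop ℕ∞) = 1 + 1 from rfl, contDiff_succ_iff_deriv, hdu]
    exact ⟨fun x ↦ (hu' x).differentiableAt, by simp, hw1⟩
  · exact intervalIntegral.integral_same
  · rw [huv L ⟨hL.le, le_rfl⟩, hv]
    simp [hyL, Real.zero_rpow hd0.ne']
  · rw [huv x (Ioo_subset_Icc_self hx)]
    exact Real.rpow_pos_of_pos (hqp x hx) _
  · rw [hdu, hdw, huv x hx]
  · rw [hdu, hwy x hx, huv x hx, hvpow' x hx]
    ring

/-! ### Beta function identities -/

/-- Legendre's duplication formula for Gamma. It reconciles `B(d, d)`, which sets the speed of the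
trajectory, with `B(d, 1/2)` in the upper bound. -/
theorem four_rpow_mul_beta_self {d : ℝ} (hd : 0 < d) :
    4 ^ d * ProbabilityTheory.beta d d = 2 * ProbabilityTheory.beta d (1 / 2) := by
  have h := Real.Gamma_mul_Gamma_add_half d
  have h1 := Real.Gamma_pos_of_pos hd
  have h2 := Real.Gamma_pos_of_pos (show 0 < d + 1 / 2 by positivity)
  have h3 := Real.Gamma_pos_of_pos (show 0 < d + d by positivity)
  unfold ProbabilityTheory.beta
  rw [Real.Gamma_one_half_eq, ← mul_div_assoc, ← mul_div_assoc, div_eq_div_iff h3.ne' h2.ne']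
  have h4 : (4 : ℝ) ^ d * 2 ^ (1 - 2 * d) = 2 := by
    rw [show (4 : ℝ) = 2 ^ (2 : ℝ) by norm_num, ← Real.rpow_mul (by norm_num),
      ← Real.rpow_add (by norm_num)]
    norm_num
  rw [two_mul d] at h
  rw [two_mul d] at h4
  linear_combination (4 ^ d * Real.Gamma d) * h + (Real.Gamma d * Real.Gamma (d + d) * √Real.pi) * h4

theorem beta_add_one_one_half {d : ℝ} (hd : 0 < d) :
    ProbabilityTheory.beta (d + 1) (1 / 2)
      = 2 * d / (2 * d + 1) * ProbabilityTheory.beta d (1 / 2) := by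
  have h2 := Real.Gamma_pos_of_pos (show 0 < d + 1 / 2 by positivity)
  unfold ProbabilityTheory.beta
  rw [show d + 1 + 1 / 2 = (d + 1 / 2) + 1 by ring, Real.Gamma_add_one hd.ne',
    Real.Gamma_add_one (by positivity)]
  field_simp

theorem beta_three_halves {d : ℝ} (hd : 0 < d) :
    ProbabilityTheory.beta d (3 / 2) = 1 / (2 * d + 1) * ProbabilityTheory.beta d (1 / 2) := by
  have h2 := Real.Gamma_pos_of_pos (show 0 < d + 1 / 2 by positivity)
  unfold ProbabilityTheory.beta
  rw [show d + 3 / 2 = (d + 1 / 2) + 1 by ring, show (3 / 2 : ℝ) = 1 / 2 + 1 by norm_num,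
    Real.Gamma_add_one (by norm_num : (1 / 2 : ℝ) ≠ 0), Real.Gamma_add_one (by positivity)]
  field_simp

/-- The substitution `s = x^(1/q)` gives `B(1/q, 3/2) / q`, and the second argument is then lowered
to `1/2`. -/
theorem integral_trajectorySpeed_one {q : ℝ} (hq : 0 < q) :
    ∫ s in (0 : ℝ)..1, trajectorySpeed q 1 s
      = ProbabilityTheory.beta (1 / q) (1 / 2) / (q + 2) := by
  have hd : 0 < 1 / q := by positivity
  -- The real square root is 0 on negative numbers, so a substitution on the half-line restricts to
  -- `(0, 1]`.
  have hz : ∀ s : ℝ, 1 < s → trajectorySpeed q 1 s = 0 := fun s hs ↦ by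
    rw [trajectorySpeed, Real.sqrt_eq_zero', Real.one_rpow, abs_of_pos (by linarith), sub_nonpos]
    exact Real.one_le_rpow hs.le hq.le
  have h := integral_comp_rpow_Ioi_of_pos (g := trajectorySpeed q 1) hd
  rw [setIntegral_eq_of_subset_of_forall_sdiff_eq_zero measurableSet_Ioi
      (Ioc_subset_Ioi_self : Ioc (0 : ℝ) 1 ⊆ Ioi 0),
    setIntegral_eq_of_subset_of_forall_sdiff_eq_zero measurableSet_Ioi
      (Ioc_subset_Ioi_self : Ioc (0 : ℝ) 1 ⊆ Ioi 0),
    ← intervalIntegral.integral_of_le zero_le_one,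
    ← intervalIntegral.integral_of_le zero_le_one] at h
  · rw [← h]
    have h1 : ∫ x in (0 : ℝ)..1, (1 / q * x ^ (1 / q - 1)) • trajectorySpeed q 1 (x ^ (1 / q))
        = ∫ x in (0 : ℝ)..1, 1 / q * (x ^ (1 / q - 1) * (1 - x) ^ (3 / 2 - 1 : ℝ)) := by
      refine intervalIntegral.integral_congr fun x hx ↦ ?_
      rw [uIcc_of_le zero_le_one] at hx
      have : (x ^ (1 / q)) ^ q = x := by
        rw [← Real.rpow_mul hx.1, one_div_mul_cancel hq.ne', Real.rpow_one]
      simp only [smul_eq_mul]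
      rw [trajectorySpeed, Real.one_rpow, abs_of_nonneg (Real.rpow_nonneg hx.1 _), this,
        Real.sqrt_eq_rpow, mul_assoc]
      norm_num
    rw [h1, intervalIntegral.integral_const_mul,
      integral_rpow_mul_one_sub_rpow hd (by norm_num), beta_three_halves hd]
    field_simp
    ring
  · intro x hx
    exact hz x (not_le.1 fun h' ↦ hx.2 ⟨hx.1, h'⟩)
  · intro x hx
    have hx1 : 1 < x := not_le.1 fun h' ↦ hx.2 ⟨hx.1, h'⟩
    rw [hz _ (Real.one_lt_rpow hx1 hd), smul_zero]

/-! ### Evaluation on the extremal and conclusion -/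

theorem isH10_deriv_of_contDiff {L : ℝ} {u : ℝ → ℝ} (hu : ContDiff ℝ 1 u)
    (h0 : u 0 = 0) (h1 : u L = 0) : IsH10 L u (deriv u) where
  continuousOn := hu.continuous.continuousOn
  left_eq_zero := h0
  right_eq_zero := h1
  memLp_deriv := by
    have hc := hu.continuous_deriv_one
    obtain ⟨C, hC⟩ := isCompact_Icc.exists_bound_of_continuousOn (hc.continuousOn (s := Icc 0 L))
    refine MemLp.of_bound hc.aestronglyMeasurable C ?_
    exact ae_restrict_of_forall_mem measurableSet_Ioo fun x hx ↦ hC x (Ioo_subset_Icc_self hx)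
  isWeakDeriv φ hφ _ hφs := by
    have hd := hφ.continuous_deriv (by norm_cast)
    rw [intervalIntegral.integral_mul_deriv_eq_deriv_mul
      (fun x _ ↦ (hu.differentiable one_ne_zero x).hasDerivAt)
      (fun x _ ↦ (hφ.differentiable (by simp) x).hasDerivAt)
      (hu.continuous_deriv_one.intervalIntegrable _ _) (hd.intervalIntegrable _ _), h0, h1]
    ring

/-- Power integral and energy of the Emden-Fowler trajectory. -/
theorem powerIntegral_and_energy_eq {L p b : ℝ} {u : ℝ → ℝ} (hL : 0 < L) (hp : 1 ≤ p)
    (hb : 0 < b) (hu : ContDiff ℝ 2 u) (h0 : u 0 = 0) (h1 : u L = 0)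
    (hpos : ∀ x ∈ Ioo 0 L, 0 < u x)
    (hode : ∀ x ∈ Icc 0 L, deriv (deriv u) x = - (b ^ 2 * (p + 1) / 2 * u x ^ p))
    (hen : ∀ x ∈ Icc 0 L, deriv u x ^ 2 = b ^ 2 * (1 - u x ^ (p + 1))) :
    powerIntegral p L u = 2 * L / (p + 3) ∧
      energy L (deriv u) = b ^ 2 * (L * (p + 1) / (p + 3)) := by
  have hnn : ∀ x ∈ Icc 0 L, 0 ≤ u x := by
    intro x hx
    rcases eq_or_lt_of_le hx.1 with h | h
    · rw [← h, h0]
    rcases eq_or_lt_of_le hx.2 with h' | h'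
    · rw [h', h1]
    · exact (hpos x ⟨h, h'⟩).le
  have hA : powerIntegral p L u = ∫ x in (0 : ℝ)..L, u x ^ (p + 1) :=
    intervalIntegral.integral_congr fun x hx ↦ by
      rw [uIcc_of_le hL.le] at hx
      simp only [abs_of_nonneg (hnn x hx)]
  have hi : IntervalIntegrable (fun x ↦ u x ^ (p + 1)) volume 0 L :=
    (hu.continuous.rpow_const fun _ ↦ Or.inr (by linarith)).intervalIntegrable _ _
  -- Integrating the first integral of the motion gives one linear relation between energy and power
  -- integral; multiplying the equation by `u` and integrating by parts gives the second, `hE2`.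
  -- Together they determine both.
  have hE1 : energy L (deriv u) = b ^ 2 * (L - powerIntegral p L u) := by
    have : energy L (deriv u) = ∫ x in (0 : ℝ)..L, b ^ 2 * (1 - u x ^ (p + 1)) :=
      intervalIntegral.integral_congr fun x hx ↦ by
        rw [uIcc_of_le hL.le] at hx
        exact hen x hx
    rw [this, intervalIntegral.integral_const_mul, intervalIntegral.integral_sub (by simp) hi, hA]
    simp
  have hu1 : ContDiff ℝ 1 (deriv u) := by
    rw [show (2 : WithTop ℕ∞) = 1 + 1 from rfl] at hu
    exact hu.deriv'
  have hE2 : energy L (deriv u) = b ^ 2 * (p + 1) / 2 * powerIntegral p L u := by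
    have h := intervalIntegral.integral_mul_deriv_eq_deriv_mul (a := 0) (b := L)
      (fun x _ ↦ (hu.differentiable two_ne_zero x).hasDerivAt)
      (fun x _ ↦ (hu1.differentiable one_ne_zero x).hasDerivAt)
      (hu1.continuous.intervalIntegrable _ _)
      (hu1.continuous_deriv_one.intervalIntegrable _ _)
    have e1 : ∫ x in (0 : ℝ)..L, u x * deriv (deriv u) x
        = ∫ x in (0 : ℝ)..L, -(b ^ 2 * (p + 1) / 2) * u x ^ (p + 1) :=
      intervalIntegral.integral_congr fun x hx ↦ by
        rw [uIcc_of_le hL.le] at hx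
        rw [hode x hx, Real.rpow_add_one' (hnn x hx) (by linarith)]
        ring
    rw [e1, intervalIntegral.integral_const_mul, ← hA, h0, h1] at h
    have e2 : energy L (deriv u) = ∫ x in (0 : ℝ)..L, deriv u x * deriv u x := by
      simp only [energy, sq]
    rw [e2]
    linarith
  have hA' : powerIntegral p L u = 2 * L / (p + 3) := by
    rw [eq_div_iff (by linarith)]
    have := hE1.symm.trans hE2
    have hb2 : b ^ 2 ≠ 0 := by positivity
    have h3 : L - powerIntegral p L u = (p + 1) / 2 * powerIntegral p L u :=
      mul_left_cancel₀ hb2 (by linarith)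
    linarith
  refine ⟨hA', ?_⟩
  rw [hE2, hA']
  ring

/-- With `r = (p + 1) / 2` the exponents are `r`, `r + 1` and `r - 1`, so everything reduces to
`r`-th powers. The factor `2 / (p + 3) * B` stands for the second Beta value. -/
theorem schmidt_constant_eq {L p B : ℝ} (hL : 0 < L) (hp : 1 ≤ p) (hB : 0 < B) :
    2 * L / (p + 3) * (L * (p + 1) / (4 * (B / (p + 3)) ^ 2 * (p + 3))) ^ ((p + 1) / 2)
      = L ^ ((p + 3) / 2) * ((p + 1) / 2) ^ ((p + 1) / 2) /
          (B ^ ((p + 3) / 2) * (2 / (p + 3) * B) ^ ((p - 1) / 2)) := by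
  obtain ⟨r, rfl⟩ : ∃ r, p = 2 * r - 1 := ⟨(p + 1) / 2, by ring⟩
  have hr : 0 < r := by linarith
  have e1 : L * (2 * r - 1 + 1) / (4 * (B / (2 * r - 1 + 3)) ^ 2 * (2 * r - 1 + 3))
      = L * (r * (r + 1)) / B ^ 2 := by
    have : (2 * r - 1 + 3) = 2 * (r + 1) := by ring
    rw [this]
    field_simp
    ring
  have e2 : 2 / (2 * r - 1 + 3) * B = B / (r + 1) := by
    have : (2 * r - 1 + 3) = 2 * (r + 1) := by ring
    rw [this]
    field_simp
  rw [e1, e2, show (2 * r - 1 + 3) / 2 = r + 1 by ring, show (2 * r - 1 + 1) / 2 = r by ring,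
    show (2 * r - 1 - 1) / 2 = r - 1 by ring, show 2 * r - 1 + 3 = 2 * (r + 1) by ring,
    Real.div_rpow (by positivity) (by positivity), Real.mul_rpow hL.le (by positivity),
    Real.mul_rpow hr.le (by positivity), Real.rpow_add_one hL.ne', Real.rpow_add_one hB.ne',
    Real.div_rpow hB.le (by positivity), Real.rpow_sub_one hB.ne',
    Real.rpow_sub_one (by positivity), ← Real.rpow_natCast B 2, ← Real.rpow_mul hB.le,
    mul_comm _ r, Real.rpow_mul hB.le]
  have h1 : 0 < B ^ r := by positivity
  have h2 : 0 < (r + 1) ^ r := by positivity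
  norm_num
  field_simp

theorem mainTheorem2 (L : ℝ) (hL : 0 < L) :
    (∀ p : ℝ, 1 ≤ p →
      -- the optimal constant is the least constant in the inequality
      IsLeast {C : ℝ | ∀ u g : ℝ → ℝ, IsH10 L u g →
          powerIntegral p L u ≤ C * energy L g ^ ((p + 1) / 2)} (optimalConstant p L) ∧
      -- it is attained by a positive classical solution of the Emden-Fowler equation
      (∃ (μ : ℝ) (u : ℝ → ℝ), 0 < μ ∧ IsH10 L u (deriv u) ∧ ContDiffOn ℝ 2 u (Icc 0 L) ∧
          (∀ x ∈ Ioo 0 L, 0 < u x) ∧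
          (∀ x ∈ Ioo 0 L, - deriv (deriv u) x = μ * u x ^ p) ∧
          optimalConstant p L =
            powerIntegral p L u / energy L (deriv u) ^ ((p + 1) / 2)) ∧
      -- its value
      optimalConstant p L =
        L ^ ((p + 3) / 2) * ((p + 1) / 2) ^ ((p + 1) / 2) /
          (ProbabilityTheory.beta (1 / (p + 1)) (1 / 2) ^ ((p + 3) / 2) *
            ProbabilityTheory.beta ((p + 2) / (p + 1)) (1 / 2) ^ ((p - 1) / 2))) ∧
    optimalConstant 1 L = L ^ 2 / Real.pi ^ 2 := by
  have main : ∀ p : ℝ, 1 ≤ p →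
      IsLeast {C : ℝ | ∀ u g : ℝ → ℝ, IsH10 L u g →
          powerIntegral p L u ≤ C * energy L g ^ ((p + 1) / 2)} (optimalConstant p L) ∧
      (∃ (μ : ℝ) (u : ℝ → ℝ), 0 < μ ∧ IsH10 L u (deriv u) ∧ ContDiffOn ℝ 2 u (Icc 0 L) ∧
          (∀ x ∈ Ioo 0 L, 0 < u x) ∧
          (∀ x ∈ Ioo 0 L, - deriv (deriv u) x = μ * u x ^ p) ∧
          optimalConstant p L =
            powerIntegral p L u / energy L (deriv u) ^ ((p + 1) / 2)) ∧
      optimalConstant p L =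
        L ^ ((p + 3) / 2) * ((p + 1) / 2) ^ ((p + 1) / 2) /
          (ProbabilityTheory.beta (1 / (p + 1)) (1 / 2) ^ ((p + 3) / 2) *
            ProbabilityTheory.beta ((p + 2) / (p + 1)) (1 / 2) ^ ((p - 1) / 2)) := by
    intro p hp
    have hd : 0 < 1 / (p + 1) := by positivity
    set B := ProbabilityTheory.beta (1 / (p + 1)) (1 / 2) with hBdef
    have hB : 0 < B := ProbabilityTheory.beta_pos hd (by norm_num)
    have hB2 : ProbabilityTheory.beta ((p + 2) / (p + 1)) (1 / 2) = 2 / (p + 3) * B := by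
      rw [show (p + 2) / (p + 1) = 1 / (p + 1) + 1 by field_simp; ring, beta_add_one_one_half hd]
      congr 1
      field_simp
      ring
    have hc := integral_trajectorySpeed_one (q := p + 1) (by linarith)
    rw [← hBdef, show p + 1 + 2 = p + 3 by ring] at hc
    have hval := schmidt_constant_eq hL hp hB
    rw [← hB2] at hval
    have hupper := fun (u g : ℝ → ℝ) (h : IsH10 L u g) (hu : ∃ x ∈ Icc 0 L, u x ≠ 0) ↦
      h.energy_pos_and_powerIntegral_le hL hp hu
    rw [hc] at hupper
    obtain ⟨u, huC, hu0, huL, hupos, hode, hen⟩ := exists_emdenFowler_solution hL hp rfl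
    set b := 1 / (p + 1) * 4 ^ (1 / (p + 1)) *
      ProbabilityTheory.beta (1 / (p + 1)) (1 / (p + 1)) / L with hb
    have hbB : b = 2 * B / ((p + 1) * L) := by
      rw [hb, mul_assoc, four_rpow_mul_beta_self hd, ← hBdef]
      field_simp
    have hb0 : 0 < b := by rw [hbB]; positivity
    obtain ⟨hA, hE⟩ := powerIntegral_and_energy_eq hL hp hb0 huC hu0 huL hupos hode hen
    have huH := isH10_deriv_of_contDiff (huC.of_le one_le_two) hu0 huL
    have hune : ∃ x ∈ Icc 0 L, u x ≠ 0 :=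
      ⟨L / 2, ⟨by linarith, by linarith⟩, (hupos _ ⟨by linarith, by linarith⟩).ne'⟩
    have hEpos : 0 < energy L (deriv u) := (hupper u _ huH hune).1
    have hratio : powerIntegral p L u / energy L (deriv u) ^ ((p + 1) / 2) = 2 * L / (p + 3) *
        (L * (p + 1) / (4 * (B / (p + 3)) ^ 2 * (p + 3))) ^ ((p + 1) / 2) := by
      -- Sharpness: the base of the power in the upper bound is the inverse energy of the
      -- trajectory, whose power integral is `2L / (p + 3)`.
      have : L * (p + 1) / (4 * (B / (p + 3)) ^ 2 * (p + 3)) = (energy L (deriv u))⁻¹ := by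
        rw [hE, hbB]
        field_simp
        ring
      rw [this, Real.inv_rpow hEpos.le, hA, div_eq_mul_inv]
    set C := 2 * L / (p + 3) *
        (L * (p + 1) / (4 * (B / (p + 3)) ^ 2 * (p + 3))) ^ ((p + 1) / 2)
    have hgreat : IsGreatest (quotientValues p L) C := by
      refine ⟨⟨u, deriv u, huH, hune, hratio.symm⟩, ?_⟩
      rintro _ ⟨v, g, hv, hv0, rfl⟩
      obtain ⟨h1, h2⟩ := hupper v g hv hv0
      rwa [div_le_iff₀ (Real.rpow_pos_of_pos h1 _)]
    have hopt : optimalConstant p L = C := hgreat.csSup_eq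
    have hCpos : 0 ≤ C := by positivity
    refine ⟨⟨fun v g hv ↦ ?_, fun D hD ↦ ?_⟩,
      ⟨b ^ 2 * (p + 1) / 2, u, by positivity, huH, huC.contDiffOn, hupos, fun x hx ↦ ?_, ?_⟩, ?_⟩
    · rw [hopt]
      by_cases hv0 : ∃ x ∈ Icc 0 L, v x ≠ 0
      · exact (hupper v g hv hv0).2
      · push Not at hv0
        have : powerIntegral p L v = 0 := by
          refine intervalIntegral.integral_zero_ae (Filter.Eventually.of_forall fun x hx ↦ ?_)
          rw [uIoc_of_le hL.le] at hx
          rw [hv0 x (Ioc_subset_Icc_self hx), abs_zero, Real.zero_rpow (by linarith)]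
        rw [this]
        exact mul_nonneg hCpos (Real.rpow_nonneg (energy_nonneg hL) _)
    · rw [hopt, ← hratio, div_le_iff₀ (Real.rpow_pos_of_pos hEpos _)]
      exact hD u (deriv u) huH
    · rw [hode x (Ioo_subset_Icc_self hx), neg_neg]
    · rw [hopt, hratio]
    · rw [hopt, hval]
  refine ⟨main, ?_⟩
  rw [(main 1 le_rfl).2.2]
  -- For `p = 1` the second Beta factor has exponent 0 and the first is `B(1/2, 1/2)²`.
  have : ProbabilityTheory.beta (1 / 2) (1 / 2) = Real.pi := by
    rw [ProbabilityTheory.beta, Real.Gamma_one_half_eq, Real.mul_self_sqrt Real.pi_pos.le]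
    norm_num
  norm_num [this]
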